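/- Let $N\ge 2$, $R>0$, $p>1$, and let $B_R\subset\mathbb R^N$ be the open ball of radius $R$ centred at the origin. Let $f:B_R\to\mathbb R$ be measurable, radially symmetric and decreasing, i.e. $f(x)=\varphi(|x|)$ for a.e. $x\in B_R$ with $\varphi:(0,R)\to\mathbb R$ nonincreasing. For $1<r<\infty$ write $f\in L^{r,\infty}(B_R)$ if $$\|f\|_{L^{r,\infty}}=\sup_{t>0}t^{1/r}f^{**}(t)<\infty,\qquad f^{**}(t)=\frac1t\int_0^t f^*(s)\,ds,\qquad f^*(s)=\inf\{\tau\ge 0:\ |\{x\in B_R:|f(x)|>\tau\}|\le s\}.$$ Let $u_p\in W^{1,p}_0(B_R)$ be any weak solution of $$-\operatorname{div}\Big((|\nabla u_p|-1)_+^{p-1}\frac{\nabla u_p}{|\nabla u_p|}\Big)=f\ \text{ in }B_R,\qquad u_p=0\ \text{ on }\partial B_R,$$ that is, $\int_{B_R}\big\langle(|\nabla u_p|-1)_+^{p-1}\frac{\nabla u_p}{|\nabla u_p|},\nabla\varphi\big\rangle\,dx=\int_{B_R}f\varphi\,dx$ for all $\varphi\in C_c^\infty(B_R)$ (the vector field being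 $0$ where $\nabla u_p=0$). 1. If $f\in L^{r,\infty}(B_R)$ for some $1<r<N$, then $\nabla u_p\in L^q(B_R)$ for every $0<q<\dfrac{Nr(p-1)}{N-r}$. 2. If $f\in L^{N,\infty}(B_R)$, then $\nabla u_p\in L^\infty(B_R)$. -/

import Mathlib

open MeasureTheory Filter Topology Set
open scoped ENNReal Distributions

noncomputable section

/-- The Euclidean space `ℝᴺ`. -/
abbrev Eucl (N : ℕ) : Type := EuclideanSpace ℝ (Fin N)

/-- The open ball `B_R` of `ℝᴺ` centred at the origin. -/
def ballR (N : ℕ) (R : ℝ) : TopologicalSpace.Opens (Eucl N) :=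
  ⟨Metric.ball 0 R, Metric.isOpen_ball⟩

/-- Lebesgue measure on the open set `Ω`. -/
def volOn {N : ℕ} (Ω : TopologicalSpace.Opens (Eucl N)) : Measure (Eucl N) :=
  volume.restrict (Ω : Set (Eucl N))

/-! ### Rearrangements and the Lorentz space `L^{r,∞}` -/

/-- The distribution function `μ_f (τ) = |{x ∈ Ω : |f x| > τ}|`. -/
def distribFun {N : ℕ} (Ω : TopologicalSpace.Opens (Eucl N)) (f : Eucl N → ℝ) (τ : ℝ≥0∞) :
    ℝ≥0∞ :=
  volOn Ω {x | τ < ‖f x‖ₑ}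

/-- The decreasing rearrangement `f^* (s) = inf {τ ≥ 0 : μ_f (τ) ≤ s}`. -/
def decrRearr {N : ℕ} (Ω : TopologicalSpace.Opens (Eucl N)) (f : Eucl N → ℝ) (s : ℝ) : ℝ≥0∞ :=
  sInf {τ : ℝ≥0∞ | distribFun Ω f τ ≤ ENNReal.ofReal s}

/-- The maximal function `f^{**} (t) = (1 / t) ∫_0^t f^* (s) ds`, for `t > 0`. -/
def maxRearr {N : ℕ} (Ω : TopologicalSpace.Opens (Eucl N)) (f : Eucl N → ℝ) (t : ℝ) : ℝ≥0∞ :=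
  (ENNReal.ofReal t)⁻¹ * ∫⁻ s in Ioo 0 t, decrRearr Ω f s

/-- The norm `‖f‖_{L^{r,∞}(Ω)} = sup_{0 < t < ∞} t^{1/r} f^{**} (t)`. -/
def lorentzNorm {N : ℕ} (Ω : TopologicalSpace.Opens (Eucl N)) (r : ℝ) (f : Eucl N → ℝ) : ℝ≥0∞ :=
  ⨆ t ∈ Ioi (0 : ℝ), ENNReal.ofReal (t ^ (1 / r)) * maxRearr Ω f t

/-- `f ∈ L^{r,∞}(Ω)` (meant for `1 < r < ∞`): `f` is Lebesgue measurable on `Ω` with finite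
norm. -/
def MemLorentz {N : ℕ} (Ω : TopologicalSpace.Opens (Eucl N)) (r : ℝ) (f : Eucl N → ℝ) : Prop :=
  AEMeasurable f (volOn Ω) ∧ lorentzNorm Ω r f < ∞

/-- `f` is radially symmetric and (not necessarily strictly) decreasing on `B_R`: almost everywhere
in `B_R` it is a nonincreasing function of `|x|`. The profile may blow up at the origin. -/
def RadiallyDecreasing (N : ℕ) (R : ℝ) (f : Eucl N → ℝ) : Prop :=
  ∃ φ : ℝ → ℝ, AntitoneOn φ (Ioo 0 R) ∧ ∀ᵐ x ∂(volOn (ballR N R)), f x = φ ‖x‖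

/-! ### Sobolev spaces -/

/-- `g` is the weak gradient of `u` on `Ω`. -/
def HasWeakGradient {N : ℕ} (Ω : TopologicalSpace.Opens (Eucl N)) (u : Eucl N → ℝ)
    (g : Eucl N → Eucl N) : Prop :=
  LocallyIntegrableOn u (Ω : Set (Eucl N)) ∧ LocallyIntegrableOn g (Ω : Set (Eucl N)) ∧
    ∀ φ : 𝓓(Ω, ℝ), ∫ x, u x • gradient (φ : Eucl N → ℝ) x ∂(volOn Ω) = -∫ x, φ x • g x ∂(volOn Ω)

/-- `u ∈ W^{1,p}(Ω)`, with weak gradient `g`. -/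
def MemW1 {N : ℕ} (Ω : TopologicalSpace.Opens (Eucl N)) (p : ℝ) (u : Eucl N → ℝ)
    (g : Eucl N → Eucl N) : Prop :=
  HasWeakGradient Ω u g ∧ MemLp u (ENNReal.ofReal p) (volOn Ω) ∧
    MemLp g (ENNReal.ofReal p) (volOn Ω)

/-- `u ∈ W_0^{1,p}(Ω)`, with weak gradient `g`: `u` lies in the closure of `C_c^∞(Ω)` in
`W^{1,p}(Ω)`. -/
def MemW10 {N : ℕ} (Ω : TopologicalSpace.Opens (Eucl N)) (p : ℝ) (u : Eucl N → ℝ)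
    (g : Eucl N → Eucl N) : Prop :=
  MemW1 Ω p u g ∧ ∃ φ : ℕ → 𝓓(Ω, ℝ),
    Tendsto (fun n => eLpNorm (fun x => φ n x - u x) (ENNReal.ofReal p) (volOn Ω)) atTop (𝓝 0) ∧
    Tendsto (fun n => eLpNorm (fun x => gradient (φ n : Eucl N → ℝ) x - g x)
      (ENNReal.ofReal p) (volOn Ω)) atTop (𝓝 0)

/-! ### The widely degenerate problem -/

/-- `H_α (ξ) = (|ξ| - 1)_+^α ξ / |ξ|`, with value `0` at `ξ = 0`. -/
def Hfun {N : ℕ} (α : ℝ) (ξ : Eucl N) : Eucl N :=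
  ((max (‖ξ‖ - 1) 0) ^ α * ‖ξ‖⁻¹) • ξ

/-- `u ∈ W_0^{1,p}(B_R)`, with weak gradient `Du`, is a weak solution of
`-div ((|∇u| - 1)_+^{p-1} ∇u / |∇u|) = f` in `B_R`, `u = 0` on `∂B_R`. -/
def IsWeakSolution (N : ℕ) (R p : ℝ) (f u : Eucl N → ℝ) (Du : Eucl N → Eucl N) : Prop :=
  MemW10 (ballR N R) p u Du ∧
    ∀ φ : 𝓓(ballR N R, ℝ),
      ∫ x, inner ℝ (Hfun (p - 1) (Du x)) (gradient (φ : Eucl N → ℝ) x) ∂(volOn (ballR N R)) =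
        ∫ x, f x * φ x ∂(volOn (ballR N R))

end

/-! The radial datum has an explicit radial flux: `τ x = -M(|x|) x`, with `M ρ = ρ^{-N} ∫_0^ρ
t^{N-1} φ`, satisfies `-div τ = f` weakly. The point is that the flux `σ = H(Du)` of every weak
solution equals `τ` a.e. (`IsWeakSolution.Hfun_ae_eq`).

The difference `σ - τ` is orthogonal to all test gradients. By density it is orthogonal to `Du`, as
soon as `τ ∈ L^{p'}`. It is also orthogonal to the radial field `V = H⁻¹(τ)`, which is formally a
gradient. Hence `∫ ⟨H(Du) - H(V), Du - V⟩ = 0`, and since `H` is monotone the integrand vanishes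
a.e. This forces `H(Du) = H(V) = τ`, although `H` is not injective.

Two facts are not immediate: `τ ∈ L^{p'}`, and the orthogonality to `V` without constructing a
potential. Both come from conditioning on `|x|`. Gradients of radial test functions show that `⟨σ -
τ, x⟩` has zero conditional expectation given `|x|`. So the radial component of `τ` is the
conditional expectation of that of `σ`, and conditional expectation preserves `L^{p'}`.

Finally `|Du| ≤ 1 + |τ|^{1/(p-1)}`, and the Lorentz norm bounds the integral of `|f|` over `B_ρ` by
`C ρ^{N(1-1/r)}`, whence `|τ| ≤ A |x|^{1-N/r}`. Both claims follow from this power. -/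

/-! ### Rearrangements and integrals over small sets -/

lemma decrRearr_antitone {N : ℕ} (Ω : TopologicalSpace.Opens (Eucl N)) (f : Eucl N → ℝ) :
    Antitone (decrRearr Ω f) := fun _ _ hst =>
  sInf_le_sInf fun _ hτ => le_trans hτ (ENNReal.ofReal_le_ofReal hst)

lemma le_decrRearr_of_lt {N : ℕ} {Ω : TopologicalSpace.Opens (Eucl N)} {f : Eucl N → ℝ}
    {s : ℝ} {τ : ℝ≥0∞} (h : ENNReal.ofReal s < distribFun Ω f τ) : τ ≤ decrRearr Ω f s := by
  refine le_sInf fun τ' hτ' => ?_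
  by_contra! hlt
  have : distribFun Ω f τ ≤ distribFun Ω f τ' :=
    measure_mono fun x hx => lt_trans hlt hx
  exact absurd (h.trans_le (this.trans hτ')) (lt_irrefl _)

lemma min_le_volume_ofReal_lt (t : ℝ) (m : ℝ≥0∞) :
    min (ENNReal.ofReal t) m ≤ volume {s ∈ Ioo (0 : ℝ) t | ENNReal.ofReal s < m} := by
  rcases eq_or_ne m ∞ with rfl | hm
  · have : {s ∈ Ioo (0 : ℝ) t | ENNReal.ofReal s < ∞} = Ioo 0 t := by ext; simp
    rw [this, Real.volume_Ioo, sub_zero]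
    exact min_le_left _ _
  · have : Ioo 0 (min t m.toReal) ⊆ {s ∈ Ioo (0 : ℝ) t | ENNReal.ofReal s < m} := by
      intro s hs
      refine ⟨⟨hs.1, hs.2.trans_le (min_le_left _ _)⟩, ?_⟩
      rw [ENNReal.ofReal_lt_iff_lt_toReal hs.1.le hm]
      exact hs.2.trans_le (min_le_right _ _)
    refine le_trans ?_ (measure_mono this)
    rw [Real.volume_Ioo, sub_zero, ENNReal.ofReal_mono.map_min, ENNReal.ofReal_toReal hm]

/-- The integral of `|f|` over a set of measure at most `t` is at most `∫₀ᵗ f^*`. -/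
lemma setLIntegral_enorm_le_lintegral_decrRearr {N : ℕ} {Ω : TopologicalSpace.Opens (Eucl N)}
    {f : Eucl N → ℝ} (hf : AEMeasurable f (volOn Ω)) {S : Set (Eucl N)} {t : ℝ}
    (hS : volOn Ω S ≤ ENNReal.ofReal t) :
    ∫⁻ x in S, ‖f x‖ₑ ∂(volOn Ω) ≤ ∫⁻ s in Ioo 0 t, decrRearr Ω f s := by
  rcases eq_or_ne (∫⁻ s in Ioo 0 t, decrRearr Ω f s) ∞ with h | h
  · simp [h]
  have hmeas : Measurable (decrRearr Ω f) := (decrRearr_antitone Ω f).measurable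
  have hfin := ae_lt_top hmeas h
  calc ∫⁻ x in S, ‖f x‖ₑ ∂(volOn Ω)
      = ∫⁻ x in S, ENNReal.ofReal ‖f x‖ ∂(volOn Ω) := by simp only [ofReal_norm]
    _ = ∫⁻ τ in Ioi 0, (volOn Ω).restrict S {x | τ < ‖f x‖} :=
        lintegral_eq_lintegral_meas_lt _ (ae_of_all _ fun _ => norm_nonneg _) hf.restrict.norm
    _ ≤ ∫⁻ τ in Ioi 0, (volume.restrict (Ioo 0 t)) {s | τ ≤ (decrRearr Ω f s).toReal} := by
        refine setLIntegral_mono' measurableSet_Ioi fun τ hτ => ?_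
        -- Layer cake: the part of `{|f| > τ}` in `S` has measure at most `min t (μ_f τ)`. This is
        -- at most the length of `{s < t : s < μ_f τ}`, where `f^* s ≥ τ`.
        have h1 : (volOn Ω).restrict S {x | τ < ‖f x‖} ≤
            min (ENNReal.ofReal t) (distribFun Ω f (ENNReal.ofReal τ)) := by
          refine le_min ((measure_mono (subset_univ _)).trans ?_) ?_
          · simpa using hS
          · refine (Measure.restrict_apply_le _ _).trans (measure_mono fun x hx => ?_)
            simp only [mem_ofPred_eq, ← ofReal_norm] at hx ⊢
            exact (ENNReal.ofReal_lt_ofReal_iff_of_nonneg (le_of_lt hτ)).2 hx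
        refine h1.trans ((min_le_volume_ofReal_lt _ _).trans ?_)
        have h2 : {s ∈ Ioo (0 : ℝ) t | ENNReal.ofReal s < distribFun Ω f (ENNReal.ofReal τ)} =
            {s | ENNReal.ofReal s < distribFun Ω f (ENNReal.ofReal τ)} ∩ Ioo 0 t := by
          ext; simp [and_comm]
        have h3 : MeasurableSet
            {s | ENNReal.ofReal s < distribFun Ω f (ENNReal.ofReal τ)} :=
          measurableSet_lt ENNReal.measurable_ofReal measurable_const
        rw [h2, ← Measure.restrict_apply h3]
        refine measure_mono_ae ?_
        filter_upwards [hfin] with s hs hlt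
        exact (ENNReal.ofReal_le_iff_le_toReal hs.ne).1 (le_decrRearr_of_lt hlt)
    _ = ∫⁻ s in Ioo 0 t, ENNReal.ofReal (decrRearr Ω f s).toReal :=
        (lintegral_eq_lintegral_meas_le _ (ae_of_all _ fun _ => ENNReal.toReal_nonneg)
          hmeas.ennreal_toReal.aemeasurable).symm
    _ ≤ ∫⁻ s in Ioo 0 t, decrRearr Ω f s := lintegral_mono fun _ => ENNReal.ofReal_toReal_le

/-- By definition `∫_0^t f^* = t f^{**}(t) ≤ ‖f‖ t^{1-1/r}`. -/
lemma MemLorentz.exists_setLIntegral_le {N : ℕ} {Ω : TopologicalSpace.Opens (Eucl N)}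
    {r : ℝ} {f : Eucl N → ℝ} (hf : MemLorentz Ω r f) :
    ∃ L : ℝ, 0 ≤ L ∧ ∀ t : ℝ, 0 < t → ∀ S : Set (Eucl N), volOn Ω S ≤ ENNReal.ofReal t →
      ∫⁻ x in S, ‖f x‖ₑ ∂(volOn Ω) ≤ ENNReal.ofReal (L * t ^ (1 - 1 / r)) := by
  refine ⟨(lorentzNorm Ω r f).toReal, ENNReal.toReal_nonneg, fun t ht S hS => ?_⟩
  refine (setLIntegral_enorm_le_lintegral_decrRearr hf.1 hS).trans ?_
  have h1 : ENNReal.ofReal (t ^ (1 / r)) * maxRearr Ω f t ≤ lorentzNorm Ω r f :=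
    le_iSup₂ (f := fun (t : ℝ) (_ : t ∈ Ioi (0 : ℝ)) =>
      ENNReal.ofReal (t ^ (1 / r)) * maxRearr Ω f t) t ht
  have h2 : ∫⁻ s in Ioo 0 t, decrRearr Ω f s = ENNReal.ofReal t * maxRearr Ω f t := by
    rw [maxRearr, ← mul_assoc, ENNReal.mul_inv_cancel (by simpa using ht) (by simp), one_mul]
  have h3 : ENNReal.ofReal t = ENNReal.ofReal (t ^ (1 - 1 / r)) * ENNReal.ofReal (t ^ (1 / r)) := by
    rw [← ENNReal.ofReal_mul (by positivity), ← Real.rpow_add ht]; simp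
  rw [h2, h3, mul_assoc, mul_comm (lorentzNorm Ω r f).toReal, ENNReal.ofReal_mul (by positivity),
    ENNReal.ofReal_toReal hf.2.ne]
  gcongr

/-! ### The explicit radial flux -/

/-- The mean `∫₀¹ s^{N-1} φ (s ρ) ds` of a radial profile. -/
noncomputable def radialMean (N : ℕ) (φ : ℝ → ℝ) (ρ : ℝ) : ℝ :=
  ∫ s in Ioo (0 : ℝ) 1, s ^ (N - 1) * φ (s * ρ)

lemma measurable_radialMean (N : ℕ) {φ : ℝ → ℝ} (hφ : Measurable φ) :
    Measurable (radialMean N φ) := by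
  have h : StronglyMeasurable (fun z : ℝ × ℝ => z.2 ^ (N - 1) * φ (z.2 * z.1)) := by
    apply Measurable.stronglyMeasurable; fun_prop
  exact (h.integral_prod_right' (ν := volume.restrict (Ioo (0 : ℝ) 1))).measurable

lemma radialMean_eq_integral_Ioo (N : ℕ) (φ : ℝ → ℝ) {ρ : ℝ} (hρ : 0 < ρ) (hN : 1 ≤ N) :
    radialMean N φ ρ = (ρ ^ N)⁻¹ * ∫ t in Ioo 0 ρ, t ^ (N - 1) * φ t := by
  have h := intervalIntegral.integral_comp_mul_right (a := 0) (b := 1)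
    (fun t => t ^ (N - 1) * φ t) hρ.ne'
  rw [zero_mul, one_mul, intervalIntegral.integral_of_le zero_le_one,
    intervalIntegral.integral_of_le hρ.le, integral_Ioc_eq_integral_Ioo,
    integral_Ioc_eq_integral_Ioo] at h
  obtain ⟨n, rfl⟩ : ∃ n, N = n + 1 := ⟨N - 1, by omega⟩
  simp only [Nat.add_sub_cancel, mul_pow, smul_eq_mul] at h ⊢
  rw [radialMean, pow_succ, mul_inv, mul_assoc, ← h, ← integral_const_mul]
  refine setIntegral_congr_fun measurableSet_Ioo fun s _ => ?_
  simp only [Nat.add_sub_cancel]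
  field_simp

lemma integrableOn_radialMean_integrand {N : ℕ} {φ : ℝ → ℝ} {ρ : ℝ} (hρ : 0 < ρ)
    (h : IntegrableOn (fun t => t ^ (N - 1) * φ t) (Ioo 0 ρ)) :
    IntegrableOn (fun s => s ^ (N - 1) * φ (s * ρ)) (Ioo 0 1) := by
  rw [← integrable_indicator_iff measurableSet_Ioo] at h
  have h2 := (h.comp_mul_right' hρ.ne').const_mul ((ρ ^ (N - 1))⁻¹)
  rw [← integrable_indicator_iff measurableSet_Ioo]
  refine h2.congr (ae_of_all _ fun s => ?_)
  simp only [indicator, mem_Ioo, mul_pos_iff_of_pos_right hρ, mul_lt_iff_lt_one_left hρ]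
  split_ifs
  · rw [mul_pow]; field_simp
  · simp

lemma setIntegral_ball_fun_norm {N : ℕ} (hN : 1 ≤ N) (φ : ℝ → ℝ) (ρ : ℝ) :
    ∫ x in Metric.ball (0 : Eucl N) ρ, φ ‖x‖ =
      N * volume.real (Metric.ball (0 : Eucl N) 1) * ∫ t in Ioo 0 ρ, t ^ (N - 1) * φ t := by
  have : Nonempty (Fin N) := ⟨⟨0, hN⟩⟩
  have h := integral_fun_norm_addHaar (volume : Measure (Eucl N)) ((Iio ρ).indicator φ)
  rw [← integral_indicator Metric.isOpen_ball.measurableSet]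
  have h1 : (Metric.ball (0 : Eucl N) ρ).indicator (fun x => φ ‖x‖) =
      fun x => (Iio ρ).indicator φ ‖x‖ := by
    ext x; simp [indicator]
  rw [h1, h, finrank_euclideanSpace_fin, nsmul_eq_mul, smul_eq_mul, mul_assoc]
  congr 2
  rw [← Ioi_inter_Iio, ← setIntegral_indicator measurableSet_Iio]
  refine integral_congr_ae (ae_of_all _ fun y => ?_)
  by_cases hy : y < ρ <;> simp [indicator, hy]

lemma radialMean_eq_setIntegral_ball {N : ℕ} (hN : 1 ≤ N) (φ : ℝ → ℝ) {ρ : ℝ} (hρ : 0 < ρ) :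
    radialMean N φ ρ = (N * volume.real (Metric.ball (0 : Eucl N) 1) * ρ ^ N)⁻¹ *
      ∫ x in Metric.ball (0 : Eucl N) ρ, φ ‖x‖ := by
  have hω : 0 < volume.real (Metric.ball (0 : Eucl N) 1) :=
    ENNReal.toReal_pos (Metric.measure_ball_pos _ _ one_pos).ne' measure_ball_lt_top.ne
  have hN' : (0 : ℝ) < N := by exact_mod_cast hN
  rw [setIntegral_ball_fun_norm hN, radialMean_eq_integral_Ioo N φ hρ hN]
  field_simp

lemma abs_radialMean_le {N : ℕ} (φ : ℝ → ℝ) {ρ : ℝ} :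
    |radialMean N φ ρ| ≤ radialMean N (fun t => |φ t|) ρ := by
  refine (abs_integral_le_integral_abs).trans_eq ?_
  refine setIntegral_congr_fun measurableSet_Ioo fun s hs => ?_
  simp [abs_mul, abs_of_pos hs.1]

/-- The field `-radialMean N φ |y| y` has divergence `-φ |y|`, weakly. -/
theorem integral_radialMean_mul_inner_gradient {N : ℕ} (hN : 1 ≤ N) {φ : ℝ → ℝ}
    (hφ : Measurable φ) (hint : Integrable (fun x : Eucl N => φ ‖x‖)) {ψ : Eucl N → ℝ}
    (hψ : ContDiff ℝ 1 ψ) (hc : HasCompactSupport ψ) :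
    ∫ y, radialMean N φ ‖y‖ * inner ℝ y (gradient ψ y) = -∫ x, φ ‖x‖ * ψ x := by
  have : Nonempty (Fin N) := ⟨⟨0, hN⟩⟩
  have hfin : Module.finrank ℝ (Eucl N) = N := finrank_euclideanSpace_fin
  set D : Eucl N → ℝ := fun y => inner ℝ y (gradient ψ y) with hD
  have hDf : ∀ y, D y = fderiv ℝ ψ y y := fun y => by
    rw [hD]; simp only; rw [real_inner_comm, ← InnerProductSpace.toDual_apply_apply (𝕜 := ℝ), toDual_gradient]
  have hDcont : Continuous D := by
    rw [funext hDf]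
    exact (hψ.continuous_fderiv (by norm_num)).clm_apply continuous_id
  obtain ⟨K, hK⟩ : ∃ K, ∀ y, ‖fderiv ℝ ψ y‖ ≤ K :=
    (hψ.continuous_fderiv (by norm_num)).bounded_above_of_compact_support (hc.fderiv ℝ)
  have hK0 : 0 ≤ K := (norm_nonneg _).trans (hK 0)
  have hDK : ∀ y, |D y| ≤ K * ‖y‖ := fun y => by
    rw [hDf]; exact (ContinuousLinearMap.le_opNorm _ _).trans (mul_le_mul_of_nonneg_right (hK y) (norm_nonneg y))
  obtain ⟨R, hR0, hR⟩ := hc.isCompact.isBounded.exists_pos_norm_lt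
  have hDR : ∀ y, R ≤ ‖y‖ → D y = 0 := fun y hy => by
    rw [hDf]
    have : y ∉ tsupport (fderiv ℝ ψ) := fun h =>
      absurd (hR y (tsupport_fderiv_subset ℝ h)) hy.not_gt
    rw [image_eq_zero_of_notMem_tsupport this]; simp
  have hψR : ∀ y, R ≤ ‖y‖ → ψ y = 0 := fun y hy =>
    image_eq_zero_of_notMem_tsupport fun h => absurd (hR y h) hy.not_gt
  set μ : Measure ℝ := volume.restrict (Ioo (0 : ℝ) 1) with hμ
  -- Strategy: apply Fubini to `Φ`, then substitute `y = x / s` for each `s`, which turns `Φ` into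
  -- `Ψ (x, s) = φ|x| · s⁻¹ D(x / s)`. The last factor is the `s`-derivative of `-ψ(x / s)`, so
  -- integrating over `(0, 1)` leaves `-φ|x| ψ x`.
  set Φ : Eucl N × ℝ → ℝ := fun z => z.2 ^ (N - 1) * φ (z.2 * ‖z.1‖) * D z.1 with hΦ
  set Ψ : Eucl N × ℝ → ℝ := fun z => (z.2 ^ N)⁻¹ * Φ (z.2⁻¹ • z.1, z.2) with hΨ
  have hΦm : Measurable Φ := by
    have := hDcont.measurable
    fun_prop
  have hΨm : Measurable Ψ := by
    fun_prop
  set A : ℝ := ∫ x : Eucl N, |φ ‖x‖|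
  have hΦi : Integrable Φ (volume.prod μ) := by
    rw [integrable_prod_iff hΦm.aestronglyMeasurable]
    constructor
    · refine ae_of_all _ fun y => ?_
      rcases eq_or_ne y 0 with rfl | hy
      · simp [hΦ, hD]
      refine Integrable.mul_const (f := fun s => s ^ (N - 1) * φ (s * ‖y‖)) ?_ (D y)
      refine integrableOn_radialMean_integrand (norm_pos_iff.2 hy) ?_
      have := (integrableOn_fun_norm_addHaar (volume : Measure (Eucl N)) (f := φ)
        (r := ‖y‖)).1 hint.integrableOn
      simpa [hfin] using this
    · have hform : ∀ y, ∫ s, ‖Φ (y, s)‖ ∂μ = radialMean N (fun t => |φ t|) ‖y‖ * |D y| := by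
        intro y
        rw [radialMean, ← integral_mul_const]
        refine setIntegral_congr_fun measurableSet_Ioo fun s hs => ?_
        simp [hΦ, abs_of_pos hs.1]
      simp only [hform]
      have hmeas : AEStronglyMeasurable
          (fun y : Eucl N => radialMean N (fun t => |φ t|) ‖y‖ * |D y|) volume := by
        have h1 := measurable_radialMean N (hφ.abs)
        have h2 := hDcont.measurable
        apply Measurable.aestronglyMeasurable
        fun_prop
      -- The mean of `|φ|` is `O(|y|^{-N})` and `D` is `O(|y|)`, so the product is `O(|y|^{1-N})`,
      -- integrable near the origin.
      have hball := integrableOn_ball_of_norm_le_rpow (μ := (volume : Measure (Eucl N)))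
        (f := fun y : Eucl N => radialMean N (fun t => |φ t|) ‖y‖ * |D y|)
        (C := (N * volume.real (Metric.ball (0 : Eucl N) 1))⁻¹ * A * K) (α := (N : ℝ) - 1) (r := R)
        (by rw [hfin]; exact hN) (by rw [hfin]; linarith) (ae_of_all _ fun y => by
          rcases eq_or_ne y 0 with rfl | hy
          · simp [hD]; positivity
          have hy' := norm_pos_iff.2 hy
          have h0 : 0 ≤ radialMean N (fun t => |φ t|) ‖y‖ := (abs_nonneg _).trans (abs_radialMean_le φ)
          rw [norm_mul, Real.norm_of_nonneg h0, Real.norm_of_nonneg (abs_nonneg (D y))]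
          have h1 : radialMean N (fun t => |φ t|) ‖y‖ ≤
              (N * volume.real (Metric.ball (0 : Eucl N) 1) * ‖y‖ ^ N)⁻¹ * A := by
            rw [radialMean_eq_setIntegral_ball hN _ hy']
            gcongr
            exact setIntegral_le_integral hint.abs (ae_of_all _ fun _ => abs_nonneg _)
          calc _ ≤ (N * volume.real (Metric.ball (0 : Eucl N) 1) * ‖y‖ ^ N)⁻¹ * A * (K * ‖y‖) := by
                gcongr; exact hDK y
            _ = _ := by
                have : ‖y‖ ^ (-((N : ℝ) - 1)) = (‖y‖ ^ N)⁻¹ * ‖y‖ := by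
                  rw [neg_sub, Real.rpow_sub hy', Real.rpow_one, Real.rpow_natCast]; field_simp
                rw [this, mul_inv]; ring) hmeas
      refine hball.integrable_of_forall_notMem_eq_zero fun y hy => ?_
      rw [Metric.mem_ball, dist_zero_right, not_lt] at hy
      simp [hDR y hy]
  have hscale : ∀ s ∈ Ioo (0 : ℝ) 1, ∀ F : ℝ → ℝ,
      ∫ x, (s ^ N)⁻¹ * F (Φ (s⁻¹ • x, s)) = ∫ y, F (Φ (y, s)) := by
    intro s hs F
    rw [integral_const_mul, Measure.integral_comp_inv_smul_of_nonneg volume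
      (fun y => F (Φ (y, s))) hs.1.le, hfin, smul_eq_mul, ← mul_assoc,
      inv_mul_cancel₀ (pow_pos hs.1 N).ne', one_mul]
  have hΨi : Integrable Ψ (volume.prod μ) := by
    rw [integrable_prod_iff' hΨm.aestronglyMeasurable]
    constructor
    · filter_upwards [hΦi.prod_left_ae, ae_restrict_mem measurableSet_Ioo] with s hs hs1
      exact (hs.comp_smul (inv_ne_zero hs1.1.ne')).const_mul (s ^ N)⁻¹
    · refine (hΦi.norm.integral_prod_right).congr ?_
      filter_upwards [ae_restrict_mem measurableSet_Ioo] with s hs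
      rw [← hscale s hs]
      refine integral_congr_ae (ae_of_all _ fun x => ?_)
      simp [hΨ, abs_of_pos hs.1]
  calc ∫ y, radialMean N φ ‖y‖ * D y = ∫ y, ∫ s, Φ (y, s) ∂μ := by
        refine integral_congr_ae (ae_of_all _ fun y => ?_)
        simp only [hΦ, radialMean, hμ, integral_mul_const]
    _ = ∫ s, (∫ y, Φ (y, s)) ∂μ := integral_integral_swap hΦi
    _ = ∫ s, (∫ x, Ψ (x, s)) ∂μ := by
        refine setIntegral_congr_fun measurableSet_Ioo fun s hs => ?_
        exact (hscale s hs id).symm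
    _ = ∫ x, ∫ s, Ψ (x, s) ∂μ := (integral_integral_swap hΨi).symm
    _ = ∫ x, -(φ ‖x‖ * ψ x) := by
        refine integral_congr_ae ?_
        filter_upwards [hΨi.prod_right_ae, Measure.ae_ne volume (0 : Eucl N)] with x hx hx0
        have hform : ∀ s ∈ Ioo (0 : ℝ) 1, Ψ (x, s) = φ ‖x‖ * (s⁻¹ * D (s⁻¹ • x)) := by
          intro s hs
          have hs0 := hs.1.ne'
          have h1 : s * ‖s⁻¹ • x‖ = ‖x‖ := by
            rw [norm_smul, Real.norm_of_nonneg (inv_nonneg.2 hs.1.le)]; field_simp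
          have h2 : s ^ N = s ^ (N - 1) * s := by rw [← pow_succ, Nat.sub_add_cancel hN]
          simp only [hΨ, hΦ, h1, h2]
          field_simp
        rw [setIntegral_congr_fun measurableSet_Ioo hform, integral_const_mul]
        -- Integrability of `s⁻¹ D(x / s)` is read off from that of `Ψ (x, ·)` by dividing by
        -- `φ|x|`.
        rcases eq_or_ne (φ ‖x‖) 0 with h0 | h0
        · simp [h0]
        have hint' : IntegrableOn (fun s : ℝ => s⁻¹ * D (s⁻¹ • x)) (Ioo 0 1) := by
          have := (hx.congr (by
            filter_upwards [ae_restrict_mem measurableSet_Ioo] with s hs using hform s hs)).const_mul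
              (φ ‖x‖)⁻¹
          refine Integrable.congr this (ae_of_all _ fun s => ?_)
          simp only
          rw [← mul_assoc, inv_mul_cancel₀ h0, one_mul]
        have hx' := norm_pos_iff.2 hx0
        have hftc := intervalIntegral.integral_eq_sub_of_hasDerivAt_of_tendsto
          (f := fun s : ℝ => - ψ (s⁻¹ • x)) (f' := fun s : ℝ => s⁻¹ * D (s⁻¹ • x))
          (a := 0) (b := 1) (fa := 0) (fb := - ψ x) one_pos (fun s hs => by
            have hd : HasDerivAt (fun s : ℝ => s⁻¹ • x) ((-(s ^ 2)⁻¹) • x) s :=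
              (hasDerivAt_inv hs.1.ne').smul_const x
            have := ((hψ.differentiable one_ne_zero (s⁻¹ • x)).hasFDerivAt.comp_hasDerivAt s hd).neg
            refine this.congr_deriv ?_
            rw [hDf, map_smul, map_smul]
            simp only [smul_eq_mul]
            ring)
          ((intervalIntegrable_iff_integrableOn_Ioo_of_le zero_le_one).2 hint') (by
            -- For `s < |x| / R` the point `x / s` lies outside the support of `ψ`.
            refine tendsto_const_nhds.congr' ?_
            filter_upwards [Ioo_mem_nhdsGT (div_pos hx' hR0)] with s hs
            rw [hψR, neg_zero]
            rw [norm_smul, Real.norm_of_nonneg (inv_nonneg.2 hs.1.le), ← div_eq_inv_mul,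
              le_div_iff₀ hs.1]
            have := (lt_div_iff₀ hR0).1 hs.2
            linarith) (by
            have : ContinuousAt (fun s : ℝ => - ψ (s⁻¹ • x)) 1 := by
              have h1 : ContinuousAt (fun s : ℝ => s⁻¹ • x) 1 :=
                (continuousAt_inv₀ one_ne_zero).smul continuousAt_const
              exact (hψ.continuous.continuousAt.comp h1).neg
            have h2 := this.tendsto
            simp only [inv_one, one_smul] at h2
            exact h2.mono_left nhdsWithin_le_nhds)
        rw [intervalIntegral.integral_of_le zero_le_one, integral_Ioc_eq_integral_Ioo] at hftc
        rw [hftc]; ring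
    _ = -∫ x, φ ‖x‖ * ψ x := integral_neg _

/-! ### Monotonicity and inversion of `H` -/

section Monotonicity

variable {N : ℕ}

lemma norm_Hfun {α : ℝ} (hα : 0 < α) (ξ : Eucl N) :
    ‖Hfun α ξ‖ = (max (‖ξ‖ - 1) 0) ^ α := by
  rcases eq_or_ne ξ 0 with rfl | h
  · simp [Hfun, Real.zero_rpow hα.ne']
  · have : 0 < ‖ξ‖ := norm_pos_iff.2 h
    rw [Hfun, norm_smul, Real.norm_of_nonneg (by positivity)]
    field_simp

lemma norm_Hfun_le {α : ℝ} (hα : 0 < α) (ξ : Eucl N) : ‖Hfun α ξ‖ ≤ ‖ξ‖ ^ α := by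
  rw [norm_Hfun hα]
  exact Real.rpow_le_rpow (le_max_right _ _)
    (max_le (by linarith) (norm_nonneg _)) hα.le

lemma measurable_Hfun (α : ℝ) : Measurable (Hfun α : Eucl N → Eucl N) := by
  unfold Hfun; fun_prop

lemma inner_Hfun_left {α : ℝ} (ξ η : Eucl N) :
    inner ℝ (Hfun α ξ) η = (max (‖ξ‖ - 1) 0) ^ α * ‖η‖ *
      inner ℝ (‖ξ‖⁻¹ • ξ) (‖η‖⁻¹ • η) := by
  rcases eq_or_ne η 0 with rfl | h
  · simp
  · have : 0 < ‖η‖ := norm_pos_iff.2 h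
    simp only [Hfun, inner_smul_left, inner_smul_right, conj_trivial]
    field_simp

lemma inner_Hfun_self {α : ℝ} (ξ : Eucl N) :
    inner ℝ (Hfun α ξ) ξ = (max (‖ξ‖ - 1) 0) ^ α * ‖ξ‖ := by
  rcases eq_or_ne ξ 0 with rfl | h
  · simp
  · have : 0 < ‖ξ‖ := norm_pos_iff.2 h
    simp only [Hfun, inner_smul_left, conj_trivial, real_inner_self_eq_norm_sq]
    field_simp

lemma inner_normalize_le_one (ξ η : Eucl N) : inner ℝ (‖ξ‖⁻¹ • ξ) (‖η‖⁻¹ • η) ≤ 1 := by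
  have h : ∀ ζ : Eucl N, ‖‖ζ‖⁻¹ • ζ‖ ≤ 1 := fun ζ => by
    rw [norm_smul, norm_inv, norm_norm]; exact inv_mul_le_one
  exact (real_inner_le_norm _ _).trans (mul_le_one₀ (h _) (norm_nonneg _) (h _))

/-- Separates moduli from directions: the first term is nonnegative because `(t - 1)_+^α` is
nondecreasing, the second by Cauchy–Schwarz. -/
lemma inner_Hfun_sub_sub {α : ℝ} (ξ η : Eucl N) :
    inner ℝ (Hfun α ξ - Hfun α η) (ξ - η) =
      ((max (‖ξ‖ - 1) 0) ^ α - (max (‖η‖ - 1) 0) ^ α) * (‖ξ‖ - ‖η‖) +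
      ((max (‖ξ‖ - 1) 0) ^ α * ‖η‖ + (max (‖η‖ - 1) 0) ^ α * ‖ξ‖) *
        (1 - inner ℝ (‖ξ‖⁻¹ • ξ) (‖η‖⁻¹ • η)) := by
  rw [inner_sub_left, inner_sub_right, inner_sub_right, inner_Hfun_self, inner_Hfun_self,
    inner_Hfun_left ξ η, inner_Hfun_left η ξ, real_inner_comm (‖ξ‖⁻¹ • ξ) (‖η‖⁻¹ • η)]
  ring

lemma posPart_rpow_mono {α : ℝ} (hα : 0 < α) {x y : ℝ} (h : x ≤ y) :
    (max (x - 1) 0) ^ α ≤ (max (y - 1) 0) ^ α :=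
  Real.rpow_le_rpow (le_max_right _ _) (max_le_max_right _ (by linarith)) hα.le

lemma posPart_rpow_sub_mul_sub_nonneg {α : ℝ} (hα : 0 < α) (x y : ℝ) :
    0 ≤ ((max (x - 1) 0) ^ α - (max (y - 1) 0) ^ α) * (x - y) := by
  rcases le_total x y with h | h
  · exact mul_nonneg_of_nonpos_of_nonpos (sub_nonpos.2 (posPart_rpow_mono hα h))
      (sub_nonpos.2 h)
  · exact mul_nonneg (sub_nonneg.2 (posPart_rpow_mono hα h)) (sub_nonneg.2 h)

lemma inner_Hfun_sub_sub_nonneg {α : ℝ} (hα : 0 < α) (ξ η : Eucl N) :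
    0 ≤ inner ℝ (Hfun α ξ - Hfun α η) (ξ - η) := by
  rw [inner_Hfun_sub_sub]
  exact add_nonneg (posPart_rpow_sub_mul_sub_nonneg hα _ _)
    (mul_nonneg (by positivity) (sub_nonneg.2 (inner_normalize_le_one ξ η)))

/-- Both terms of the splitting vanish, so the moduli of the two fluxes agree. If that common
modulus is zero, both fluxes are zero; otherwise the angular term forces equal directions. Inside
the unit ball `ξ` and `η` may still differ. -/
lemma Hfun_eq_of_inner_eq_zero {α : ℝ} (hα : 0 < α) {ξ η : Eucl N}
    (h : inner ℝ (Hfun α ξ - Hfun α η) (ξ - η) = 0) : Hfun α ξ = Hfun α η := by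
  rw [inner_Hfun_sub_sub] at h
  have h1 := posPart_rpow_sub_mul_sub_nonneg hα ‖ξ‖ ‖η‖
  have hc := inner_normalize_le_one ξ η
  have h2 : 0 ≤ ((max (‖ξ‖ - 1) 0) ^ α * ‖η‖ + (max (‖η‖ - 1) 0) ^ α * ‖ξ‖) *
        (1 - inner ℝ (‖ξ‖⁻¹ • ξ) (‖η‖⁻¹ • η)) :=
    mul_nonneg (by positivity) (sub_nonneg.2 hc)
  have h3 : ((max (‖ξ‖ - 1) 0) ^ α - (max (‖η‖ - 1) 0) ^ α) * (‖ξ‖ - ‖η‖) = 0 := by linarith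
  have h4 : ((max (‖ξ‖ - 1) 0) ^ α * ‖η‖ + (max (‖η‖ - 1) 0) ^ α * ‖ξ‖) *
        (1 - inner ℝ (‖ξ‖⁻¹ • ξ) (‖η‖⁻¹ • η)) = 0 := by linarith
  have hab : (max (‖ξ‖ - 1) 0) ^ α = (max (‖η‖ - 1) 0) ^ α := by
    rcases mul_eq_zero.1 h3 with h | h
    · linarith
    · rw [sub_eq_zero.1 h]
  rcases (Real.rpow_nonneg (le_max_right (‖ξ‖ - 1) 0) α).eq_or_lt with h0 | h0
  · have e1 : Hfun α ξ = 0 := by rw [← norm_eq_zero, norm_Hfun hα, ← h0]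
    have e2 : Hfun α η = 0 := by rw [← norm_eq_zero, norm_Hfun hα, ← hab, ← h0]
    rw [e1, e2]
  · have hne : ∀ ζ : Eucl N, 0 < (max (‖ζ‖ - 1) 0) ^ α → 0 < ‖ζ‖ := by
      intro ζ hζ
      by_contra! hle
      rw [max_eq_right (by linarith), Real.zero_rpow hα.ne'] at hζ
      exact lt_irrefl _ hζ
    have hξ := hne ξ h0
    have hη := hne η (hab ▸ h0)
    have hpos : 0 < (max (‖ξ‖ - 1) 0) ^ α * ‖η‖ + (max (‖η‖ - 1) 0) ^ α * ‖ξ‖ := by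
      rw [← hab]; positivity
    have hc1 : inner ℝ (‖ξ‖⁻¹ • ξ) (‖η‖⁻¹ • η) = 1 := by
      rcases mul_eq_zero.1 h4 with h | h
      · exact absurd h hpos.ne'
      · linarith
    have hn : ∀ ζ : Eucl N, 0 < ‖ζ‖ → ‖‖ζ‖⁻¹ • ζ‖ = 1 := fun ζ hζ => by
      rw [norm_smul, norm_inv, norm_norm, inv_mul_cancel₀ hζ.ne']
    have heq := (inner_eq_one_iff_of_norm_eq_one (hn ξ hξ) (hn η hη)).1 hc1
    rw [Hfun, Hfun, mul_smul, mul_smul, heq, hab]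

/-- A right inverse of `Hfun`. -/
noncomputable def HfunInv (α : ℝ) (ζ : Eucl N) : Eucl N := ((1 + ‖ζ‖ ^ (1 / α)) * ‖ζ‖⁻¹) • ζ

lemma norm_HfunInv_le (α : ℝ) (ζ : Eucl N) : ‖HfunInv α ζ‖ ≤ 1 + ‖ζ‖ ^ (1 / α) := by
  rw [HfunInv, norm_smul, Real.norm_of_nonneg (by positivity), mul_assoc]
  exact mul_le_of_le_one_right (by positivity) inv_mul_le_one

lemma Hfun_HfunInv {α : ℝ} (hα : 0 < α) (ζ : Eucl N) : Hfun α (HfunInv α ζ) = ζ := by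
  rcases eq_or_ne ζ 0 with rfl | h
  · simp [HfunInv, Hfun]
  · have h0 : 0 < ‖ζ‖ := norm_pos_iff.2 h
    have hn : ‖HfunInv α ζ‖ = 1 + ‖ζ‖ ^ (1 / α) := by
      rw [HfunInv, norm_smul, Real.norm_of_nonneg (by positivity)]
      field_simp
    rw [Hfun, hn, add_sub_cancel_left, max_eq_left (by positivity), ← Real.rpow_mul h0.le,
      one_div_mul_cancel hα.ne', Real.rpow_one, HfunInv, smul_smul]
    have : 0 < 1 + ‖ζ‖ ^ (1 / α) := by positivity
    convert one_smul ℝ ζ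
    field_simp

lemma norm_le_of_Hfun_eq {α : ℝ} (hα : 0 < α) {ξ ζ : Eucl N} (h : Hfun α ξ = ζ) :
    ‖ξ‖ ≤ 1 + ‖ζ‖ ^ (1 / α) := by
  rw [← h, norm_Hfun hα, ← Real.rpow_mul (le_max_right _ _), mul_one_div_cancel hα.ne',
    Real.rpow_one]
  linarith [le_max_left (‖ξ‖ - 1) 0]

end Monotonicity

/-! ### Conditioning on `|x|` -/

section Radial

variable {N : ℕ} {R : ℝ}

instance (N : ℕ) (R : ℝ) : IsFiniteMeasure (volOn (ballR N R)) :=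
  ⟨by simpa [volOn, ballR] using measure_ball_lt_top⟩

/-- Every field `g (|x|²) x` with `g` smooth and vanishing near and beyond `R²` is the gradient of
a test function on `B_R`. -/
lemma exists_testFunction_gradient_eq (hR : 0 < R) {g : ℝ → ℝ} (hg : ContDiff ℝ (⊤ : ℕ∞) g)
    (hc : HasCompactSupport g) (hs : tsupport g ⊆ Iio (R ^ 2)) :
    ∃ ψ : 𝓓(ballR N R, ℝ), ∀ x, gradient (ψ : Eucl N → ℝ) x = g (‖x‖ ^ 2) • x := by
  -- Adjoining `0` makes the set nonempty and `b ≥ 0`, so that `√b` is a meaningful radius.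
  obtain ⟨b, hbmem, hb⟩ : ∃ b, IsGreatest (tsupport g ∪ {0}) b :=
    (hc.isCompact.union isCompact_singleton).exists_isGreatest ⟨0, by simp⟩
  have hb0 : 0 ≤ b := hb (by simp)
  have hbR : b < R ^ 2 := by
    rcases hbmem with h | h
    · exact hs h
    · rw [mem_singleton_iff.1 h]; positivity
  -- The factor `1/2` cancels `∇|x|² = 2x`. Starting the primitive at `R²`, beyond the support of
  -- `g`, makes `G` vanish past `b`.
  set G : ℝ → ℝ := fun t => 1 / 2 * ∫ s in (R ^ 2)..t, g s with hG
  have hGd : ∀ t, HasDerivAt G (1 / 2 * g t) t := fun t =>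
    (hg.continuous.integral_hasStrictDerivAt _ t).hasDerivAt.const_mul _
  have hGs : ContDiff ℝ (⊤ : ℕ∞) G := by
    rw [contDiff_infty_iff_deriv]
    refine ⟨fun t => (hGd t).differentiableAt, ?_⟩
    rw [show deriv G = fun t => 1 / 2 * g t from funext fun t => (hGd t).deriv]
    exact contDiff_const.mul hg
  have hG0 : ∀ t, b < t → G t = 0 := by
    intro t ht
    have : ∫ s in (R ^ 2)..t, g s = ∫ s in (R ^ 2)..t, (0 : ℝ) := by
      refine intervalIntegral.integral_congr fun s hs' => ?_
      have hbs : b < s := (lt_min hbR ht).trans_le hs'.1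
      exact image_eq_zero_of_notMem_tsupport fun h => absurd (hb (Or.inl h)) hbs.not_ge
    rw [hG]; simp only [this]; simp
  have hsupp : tsupport (fun x : Eucl N => G (‖x‖ ^ 2)) ⊆ Metric.closedBall 0 (Real.sqrt b) := by
    refine closure_minimal (fun x hx => ?_) Metric.isClosed_closedBall
    rw [mem_closedBall_zero_iff]
    refine Real.le_sqrt_of_sq_le ?_
    by_contra! hlt
    exact hx (hG0 _ hlt)
  refine ⟨⟨fun x => G (‖x‖ ^ 2), hGs.comp (contDiff_norm_sq ℝ), ?_, ?_⟩, fun x => ?_⟩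
  · exact (isCompact_closedBall _ _).of_isClosed_subset (isClosed_tsupport _) hsupp
  · refine hsupp.trans (Metric.closedBall_subset_ball ?_)
    rw [Real.sqrt_lt' hR]; exact hbR
  · refine HasGradientAt.gradient ?_
    rw [hasGradientAt_iff_hasFDerivAt]
    have h := (hGd (‖x‖ ^ 2)).comp_hasFDerivAt x (hasStrictFDerivAt_norm_sq x).hasFDerivAt
    refine h.congr_fderiv ?_
    ext y
    simp
    ring

/-- The `σ`-algebra of radial events. -/
noncomputable abbrev radialSigma (N : ℕ) : MeasurableSpace (Eucl N) :=
  MeasurableSpace.comap (fun x : Eucl N => ‖x‖ ^ 2) inferInstance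

lemma radialSigma_le : radialSigma N ≤ (inferInstance : MeasurableSpace (Eucl N)) :=
  Measurable.comap_le (by fun_prop)

lemma stronglyMeasurable_comp_norm {k : ℝ → ℝ} (hk : Measurable k) :
    StronglyMeasurable[radialSigma N] (fun x : Eucl N => k ‖x‖) := by
  have h : (fun x : Eucl N => k ‖x‖) = (fun t => k (Real.sqrt t)) ∘ fun x => ‖x‖ ^ 2 := by
    ext x; simp [Real.sqrt_sq (norm_nonneg x)]
  rw [h]
  exact ((hk.comp Real.continuous_sqrt.measurable).comp
    (comap_measurable _)).stronglyMeasurable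

/-- `h` has vanishing integral against all smooth radial functions compactly supported in `B_R`. -/
def RadiallyNull (R : ℝ) (h : Eucl N → ℝ) : Prop :=
  ∀ g : ℝ → ℝ, ContDiff ℝ (⊤ : ℕ∞) g → HasCompactSupport g → tsupport g ⊆ Iio (R ^ 2) →
    ∫ x, g (‖x‖ ^ 2) * h x ∂(volOn (ballR N R)) = 0

/-- The conditional expectation has the form `k(|x|²)`. Against the law of `|x|²`, `k` integrates to
zero with every test function on `(-∞, R²)`, so the fundamental lemma of the calculus of variations
gives `k = 0` a.e. there. Using `|x|²` rather than `|x|` keeps the test functions smooth at the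
origin. -/
lemma RadiallyNull.condExp_ae_eq_zero {h : Eucl N → ℝ} (hint : Integrable h (volOn (ballR N R)))
    (hn : RadiallyNull R h) : (volOn (ballR N R))[h | radialSigma N] =ᵐ[volOn (ballR N R)] 0 := by
  set μ := volOn (ballR N R) with hμ
  have hT : Measurable (fun x : Eucl N => ‖x‖ ^ 2) := by fun_prop
  obtain ⟨k, hk, hkeq⟩ := (stronglyMeasurable_condExp (μ := μ) (m := radialSigma N)
    (f := h)).measurable.exists_eq_measurable_comp
  have hkint : Integrable k (μ.map fun x => ‖x‖ ^ 2) := by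
    rw [integrable_map_measure hk.aestronglyMeasurable hT.aemeasurable]
    have := integrable_condExp (μ := μ) (m := radialSigma N) (f := h)
    rwa [hkeq] at this
  have key := isOpen_Iio.ae_eq_zero_of_integral_contDiff_smul_eq_zero (U := Iio (R ^ 2))
    (μ := μ.map fun x => ‖x‖ ^ 2) (f := k) (hkint.locallyIntegrable.locallyIntegrableOn _) (by
      intro g hg hc hs
      have hgm : StronglyMeasurable[radialSigma N] (fun x : Eucl N => g (‖x‖ ^ 2)) :=
        (hg.continuous.measurable.comp (comap_measurable _)).stronglyMeasurable
      have hgint : Integrable ((fun x : Eucl N => g (‖x‖ ^ 2)) * h) μ := by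
        obtain ⟨C, hC⟩ := hc.exists_bound_of_continuous hg.continuous
        exact hint.bdd_mul (hgm.mono radialSigma_le).aestronglyMeasurable
          (ae_of_all _ fun x => hC _)
      rw [integral_map (f := fun t => g t • k t) hT.aemeasurable
        (hg.continuous.measurable.smul hk).aestronglyMeasurable]
      have h1 := condExp_mul_of_stronglyMeasurable_left hgm hgint hint
      rw [← hn g hg hc hs, ← integral_condExp (radialSigma_le (N := N)) (f := fun x => g (‖x‖ ^ 2) * h x)]
      refine integral_congr_ae ?_
      filter_upwards [h1] with x hx
      have h2 : (μ[h | radialSigma N]) x = k (‖x‖ ^ 2) := congrFun hkeq x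
      rw [smul_eq_mul, ← h2]
      exact hx.symm)
  have key2 := ae_of_ae_map hT.aemeasurable key
  have hball : ∀ᵐ x ∂μ, x ∈ Metric.ball (0 : Eucl N) R :=
    ae_restrict_mem Metric.isOpen_ball.measurableSet
  filter_upwards [key2, hball] with x hx hxR
  rw [hkeq]
  rw [mem_ball_zero_iff] at hxR
  exact hx (pow_lt_pow_left₀ hxR (norm_nonneg x) two_ne_zero)

/-- Passes from smooth radial weights to measurable, possibly unbounded ones by pulling `k` out of
the conditional expectation. -/
lemma RadiallyNull.integral_mul_eq_zero {h : Eucl N → ℝ}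
    (hint : Integrable h (volOn (ballR N R))) (hn : RadiallyNull R h) {k : ℝ → ℝ}
    (hk : Measurable k) (hkh : Integrable (fun x => k ‖x‖ * h x) (volOn (ballR N R))) :
    ∫ x, k ‖x‖ * h x ∂(volOn (ballR N R)) = 0 := by
  rw [← integral_condExp (radialSigma_le (N := N))]
  refine integral_eq_zero_of_ae ?_
  filter_upwards [condExp_mul_of_stronglyMeasurable_left
    (stronglyMeasurable_comp_norm (N := N) hk) hkh hint, hn.condExp_ae_eq_zero hint] with x h1 h2
  refine h1.trans ?_
  simp [h2]

/-- The hypothesis identifies `b|x|` with the conditional expectation of `a`, which inherits `L^q`.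
The weight `|x|` appears because radial test gradients are multiples of `x`. -/
lemma RadiallyNull.memLp {a : Eucl N → ℝ} {q : ℝ≥0∞} (hq : 1 ≤ q)
    (ha : MemLp a q (volOn (ballR N R))) {b : ℝ → ℝ} (hb : Measurable b) (hN : 1 ≤ N)
    (hbint : Integrable (fun x => b ‖x‖) (volOn (ballR N R)))
    (hn : RadiallyNull R fun x => ‖x‖ * (a x - b ‖x‖)) :
    MemLp (fun x => b ‖x‖) q (volOn (ballR N R)) := by
  have : Nonempty (Fin N) := ⟨⟨0, hN⟩⟩
  set μ := volOn (ballR N R) with hμ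
  have haint : Integrable a μ := ha.integrable hq
  have hab : Integrable (fun x => a x - b ‖x‖) μ := haint.sub hbint
  have hball : ∀ᵐ x ∂μ, x ∈ Metric.ball (0 : Eucl N) R :=
    ae_restrict_mem Metric.isOpen_ball.measurableSet
  have h0int : Integrable (fun x => ‖x‖ * (a x - b ‖x‖)) μ := by
    refine hab.bdd_mul (c := R) continuous_norm.aestronglyMeasurable ?_
    filter_upwards [hball] with x hx
    rw [norm_norm]; exact (mem_ball_zero_iff.1 hx).le
  have hne : ∀ᵐ x ∂μ, x ≠ 0 := ae_restrict_of_ae (Measure.ae_ne volume 0)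
  have heq : (fun x => ‖x‖⁻¹ * (‖x‖ * (a x - b ‖x‖))) =ᵐ[μ] fun x => a x - b ‖x‖ := by
    filter_upwards [hne] with x hx
    rw [← mul_assoc, inv_mul_cancel₀ (norm_ne_zero_iff.2 hx), one_mul]
  -- The weight is removed by pulling out the radial, unbounded factor `|x|⁻¹`.
  have h1 := condExp_mul_of_stronglyMeasurable_left (μ := μ)
    (stronglyMeasurable_comp_norm (N := N) measurable_inv) (hab.congr heq.symm) h0int
  have h2 : μ[fun x => a x - b ‖x‖ | radialSigma N] =ᵐ[μ] 0 := by
    refine (condExp_congr_ae heq.symm).trans (h1.trans ?_)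
    filter_upwards [hn.condExp_ae_eq_zero h0int] with x hx
    have hx' : (μ[fun x => ‖x‖ * (a x - b ‖x‖) | radialSigma N]) x = 0 := hx
    simp [hx']
  have h3 : μ[fun x => b ‖x‖ | radialSigma N] = fun x => b ‖x‖ :=
    condExp_of_stronglyMeasurable radialSigma_le (stronglyMeasurable_comp_norm hb) hbint
  have h4 := condExp_sub haint hbint (radialSigma N)
  refine (memLp_congr_ae ?_).1 (ha.condExp (m := radialSigma N) hq)
  filter_upwards [h2, h4] with x hx2 hx4
  have : (μ[fun x => a x - b ‖x‖ | radialSigma N]) x =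
    (μ[a | radialSigma N]) x - (μ[fun x => b ‖x‖ | radialSigma N]) x := hx4
  rw [hx2, h3, Pi.zero_apply] at this
  linarith

end Radial

/-! ### Identification of the flux -/

variable {N : ℕ} {R : ℝ}

lemma ae_mem_ball_volOn (N : ℕ) (R : ℝ) :
    ∀ᵐ x ∂(volOn (ballR N R)), x ∈ Metric.ball (0 : Eucl N) R :=
  ae_restrict_mem Metric.isOpen_ball.measurableSet

/-- Monotonicity on `(0, R)` supplies measurability; extension by zero lets the divergence identity
be used on all of `ℝᴺ`. -/
lemma RadiallyDecreasing.exists_measurable_profile {f : Eucl N → ℝ}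
    (hN : 1 ≤ N) (hf : RadiallyDecreasing N R f) :
    ∃ φ : ℝ → ℝ, Measurable φ ∧ (∀ ρ, R ≤ ρ → φ ρ = 0) ∧
      f =ᵐ[volOn (ballR N R)] fun x => φ ‖x‖ := by
  have : Nonempty (Fin N) := ⟨⟨0, hN⟩⟩
  obtain ⟨φ, hφ, hfφ⟩ := hf
  refine ⟨(Ioo 0 R).indicator φ, ?_, fun ρ hρ => ?_, ?_⟩
  · refine measurable_of_restrict_of_restrict_compl (measurableSet_Ioo (a := (0 : ℝ)) (b := R)) ?_ ?_
    · have h : Antitone ((Ioo 0 R).domRestrict φ) := fun a b hab => hφ a.2 b.2 hab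
      convert h.measurable using 1
      ext x
      exact indicator_of_mem x.2 φ
    · convert (measurable_const : Measurable fun _ : ((Ioo 0 R)ᶜ : Set ℝ) => (0 : ℝ)) using 1
      ext x
      exact indicator_of_notMem x.2 φ
  · exact indicator_of_notMem (fun h => absurd h.2 hρ.not_gt) φ
  · have hne : ∀ᵐ x ∂(volOn (ballR N R)), x ≠ 0 := ae_restrict_of_ae (Measure.ae_ne volume 0)
    filter_upwards [hfφ, hne, ae_mem_ball_volOn N R] with x hx hx0 hxR
    rw [hx, indicator_of_mem]
    exact ⟨norm_pos_iff.2 hx0, mem_ball_zero_iff.1 hxR⟩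

lemma MemLorentz.exists_setIntegral_ball_le (hN : 1 ≤ N) {r : ℝ}
    {f : Eucl N → ℝ} (hf : MemLorentz (ballR N R) r f) :
    ∃ L : ℝ, 0 ≤ L ∧ ∀ ρ : ℝ, 0 < ρ → ρ ≤ R →
      IntegrableOn f (Metric.ball 0 ρ) ∧
      ∫ x in Metric.ball (0 : Eucl N) ρ, |f x| ≤ L * (ρ ^ N) ^ (1 - 1 / r) := by
  have : Nonempty (Fin N) := ⟨⟨0, hN⟩⟩
  obtain ⟨L, hL0, hL⟩ := hf.exists_setLIntegral_le
  set ω := volume.real (Metric.ball (0 : Eucl N) 1) with hω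
  have hω0 : 0 < ω :=
    ENNReal.toReal_pos (Metric.measure_ball_pos _ _ one_pos).ne' measure_ball_lt_top.ne
  refine ⟨L * ω ^ (1 - 1 / r), by positivity, fun ρ hρ hρR => ?_⟩
  have hsub : Metric.ball (0 : Eucl N) ρ ⊆ Metric.ball 0 R := Metric.ball_subset_ball hρR
  have hrestr : (volOn (ballR N R)).restrict (Metric.ball 0 ρ) =
      volume.restrict (Metric.ball (0 : Eucl N) ρ) := by
    rw [volOn, Measure.restrict_restrict Metric.isOpen_ball.measurableSet]
    congr 1
    exact inter_eq_left.2 hsub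
  have hvol : volOn (ballR N R) (Metric.ball 0 ρ) ≤ ENNReal.ofReal (ρ ^ N * ω) := by
    refine (Measure.restrict_apply_le _ _).trans ?_
    rw [Measure.addHaar_ball_of_pos volume _ hρ, finrank_euclideanSpace_fin,
      ENNReal.ofReal_mul (by positivity), hω, Measure.real,
      ENNReal.ofReal_toReal measure_ball_lt_top.ne]
  have h := hL _ (by positivity) _ hvol
  rw [hrestr] at h
  have hm : AEStronglyMeasurable f (volume.restrict (Metric.ball 0 ρ)) := by
    rw [← hrestr]
    exact hf.1.aestronglyMeasurable.restrict
  refine ⟨⟨hm, h.trans_lt ENNReal.ofReal_lt_top⟩, ?_⟩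
  have h2 := integral_norm_eq_lintegral_enorm hm
  simp only [Real.norm_eq_abs] at h2
  rw [h2]
  refine ENNReal.toReal_le_of_le_ofReal (by positivity) (h.trans_eq ?_)
  rw [Real.mul_rpow (by positivity) hω0.le]
  congr 1; ring

lemma integral_inner_gradient_add_radialMean (hN : 1 ≤ N) {φ : ℝ → ℝ}
    (hφ : Measurable φ) (hint : Integrable (fun x : Eucl N => φ ‖x‖)) (ψ : 𝓓(ballR N R, ℝ)) :
    ∫ x, inner ℝ (-(radialMean N φ ‖x‖ • x)) (gradient (ψ : Eucl N → ℝ) x) ∂(volOn (ballR N R)) =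
      ∫ x, φ ‖x‖ * ψ x ∂(volOn (ballR N R)) := by
  have hout : ∀ x, x ∉ ((ballR N R : TopologicalSpace.Opens _) : Set (Eucl N)) →
      gradient (ψ : Eucl N → ℝ) x = 0 := by
    intro x hx
    have : x ∉ tsupport (fderiv ℝ (ψ : Eucl N → ℝ)) := fun h =>
      hx (ψ.tsupport_subset (tsupport_fderiv_subset ℝ h))
    rw [gradient, image_eq_zero_of_notMem_tsupport this, map_zero]
  have hout' : ∀ x, x ∉ ((ballR N R : TopologicalSpace.Opens _) : Set (Eucl N)) → ψ x = 0 :=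
    fun x hx => image_eq_zero_of_notMem_tsupport fun h => hx (ψ.tsupport_subset h)
  rw [volOn, setIntegral_eq_integral_of_forall_compl_eq_zero fun x hx => by rw [hout x hx]; simp,
    setIntegral_eq_integral_of_forall_compl_eq_zero fun x hx => by rw [hout' x hx]; simp]
  have h := integral_radialMean_mul_inner_gradient hN hφ hint (ψ.contDiff.of_le (by simp))
    ψ.hasCompactSupport
  rw [← neg_eq_iff_eq_neg, ← integral_neg] at h
  rw [← h]
  simp only [inner_neg_left, inner_smul_left, conj_trivial]

lemma integrable_inner_of_memLp {α : Type*} {m : MeasurableSpace α} {μ : Measure α} {p q : ℝ≥0∞}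
    [ENNReal.HolderConjugate p q] {F G : α → Eucl N} (hF : MemLp F p μ) (hG : MemLp G q μ) :
    Integrable (fun x => inner ℝ (F x) (G x)) μ := by
  rw [← memLp_one_iff_integrable]
  refine MemLp.of_bilin (fun a b => inner ℝ a b) 1 hF hG (hF.1.inner hG.1) (ae_of_all _ fun x => ?_)
  rw [one_mul]
  exact norm_inner_le_norm (F x) (G x)

/-- A field in `L^q` orthogonal to all gradients of test functions is orthogonal to the gradient
of any function in `W_0^{1,p}`. -/
lemma MemW10.integral_inner_eq_zero {Ω : TopologicalSpace.Opens (Eucl N)} {p q : ℝ}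
    {u : Eucl N → ℝ} {Du F : Eucl N → Eucl N} (hu : MemW10 Ω p u Du) (hpq : q.HolderConjugate p)
    (hF : MemLp F (ENNReal.ofReal q) (volOn Ω))
    (h : ∀ ψ : 𝓓(Ω, ℝ), Integrable (fun x => inner ℝ (F x) (gradient (ψ : Eucl N → ℝ) x)) (volOn Ω) ∧
      ∫ x, inner ℝ (F x) (gradient (ψ : Eucl N → ℝ) x) ∂(volOn Ω) = 0) :
    ∫ x, inner ℝ (F x) (Du x) ∂(volOn Ω) = 0 := by
  have := hpq.ennrealOfReal
  obtain ⟨⟨-, -, hDu⟩, ψ, -, hψ⟩ := hu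
  have hFD := integrable_inner_of_memLp hF hDu
  have hbound : ∀ n, ‖∫ x, inner ℝ (F x) (Du x) ∂(volOn Ω)‖ₑ ≤
      eLpNorm F (ENNReal.ofReal q) (volOn Ω) *
      eLpNorm (fun x => gradient (ψ n : Eucl N → ℝ) x - Du x) (ENNReal.ofReal p) (volOn Ω) := by
    intro n
    have hgm : AEStronglyMeasurable (fun x => gradient (ψ n : Eucl N → ℝ) x) (volOn Ω) := by
      have hc : Continuous (fun x => gradient (ψ n : Eucl N → ℝ) x) :=
        (LinearIsometryEquiv.continuous _).comp ((ψ n).contDiff.continuous_fderiv (by simp))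
      exact hc.aestronglyMeasurable
    have h1 : ∫ x, inner ℝ (F x) (gradient (ψ n : Eucl N → ℝ) x - Du x) ∂(volOn Ω) =
        -∫ x, inner ℝ (F x) (Du x) ∂(volOn Ω) := by
      simp only [inner_sub_right]
      rw [integral_sub (h (ψ n)).1 hFD, (h (ψ n)).2, zero_sub]
    rw [← enorm_neg, ← h1]
    refine (enorm_integral_le_lintegral_enorm _).trans ?_
    rw [← eLpNorm_one_eq_lintegral_enorm]
    refine (eLpNorm_le_eLpNorm_mul_eLpNorm'_of_norm (p := ENNReal.ofReal q)
      (q := ENNReal.ofReal p) hF.1 (hgm.sub hDu.1)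
      (fun a b => inner ℝ a b) 1 (ae_of_all _ fun x => ?_)).trans ?_
    · simpa using norm_inner_le_norm (𝕜 := ℝ) (F x) (gradient (ψ n : Eucl N → ℝ) x - Du x)
    · simp [Pi.sub_def]
  have hlim := ENNReal.Tendsto.const_mul (a := eLpNorm F (ENNReal.ofReal q) (volOn Ω)) hψ
    (Or.inr hF.2.ne)
  rw [mul_zero] at hlim
  have := ge_of_tendsto' hlim hbound
  simpa using this

/-- The flux of any weak solution with radial datum is the explicit radial field. -/
theorem IsWeakSolution.Hfun_ae_eq {p : ℝ} (hR : 0 < R) (hN : 1 ≤ N) (hp : 1 < p)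
    {f u : Eucl N → ℝ} {Du : Eucl N → Eucl N} (hu : IsWeakSolution N R p f u Du)
    {φ : ℝ → ℝ} (hφ : Measurable φ) (hint : Integrable (fun x : Eucl N => φ ‖x‖))
    (hfφ : f =ᵐ[volOn (ballR N R)] fun x => φ ‖x‖)
    (hMint : Integrable (fun x : Eucl N => -(‖x‖ * radialMean N φ ‖x‖)) (volOn (ballR N R))) :
    ∀ᵐ x ∂(volOn (ballR N R)), Hfun (p - 1) (Du x) = -(radialMean N φ ‖x‖ • x) := by
  set μ := volOn (ballR N R) with hμ
  set M := radialMean N φ with hM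
  have hMm : Measurable M := measurable_radialMean N hφ
  set σ : Eucl N → Eucl N := fun x => Hfun (p - 1) (Du x) with hσ
  set τ : Eucl N → Eucl N := fun x => -(M ‖x‖ • x) with hτ
  have hp1 : 0 < p - 1 := by linarith
  have hp0 : 0 < p := by linarith
  have hpq : (p / (p - 1)).HolderConjugate p := (Real.HolderConjugate.conjExponent hp).symm
  have := hpq.ennrealOfReal
  have hDu : MemLp Du (ENNReal.ofReal p) μ := hu.1.1.2.2
  have hσm : MemLp σ (ENNReal.ofReal (p / (p - 1))) μ := by
    have h := hDu.norm_rpow_div (ENNReal.ofReal (p - 1))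
    rw [ENNReal.toReal_ofReal hp1.le, ← ENNReal.ofReal_div_of_pos hp1] at h
    refine h.mono ((measurable_Hfun (p - 1)).comp_aemeasurable hDu.1.aemeasurable
      ).aestronglyMeasurable (ae_of_all _ fun x => ?_)
    rw [Real.norm_of_nonneg (by positivity)]
    exact norm_Hfun_le hp1 _
  have hτmeas : Measurable τ := by fun_prop
  have hnormτ : ∀ x, ‖τ x‖ = ‖-(‖x‖ * M ‖x‖)‖ := fun x => by
    simp [hτ, norm_smul, mul_comm]
  have hσ1 : Integrable σ μ := hσm.integrable (by
    rw [← ENNReal.ofReal_one]; exact ENNReal.ofReal_le_ofReal hpq.lt.le)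
  have hτ1 : Integrable τ μ := hMint.mono hτmeas.aestronglyMeasurable
    (ae_of_all _ fun x => (hnormτ x).le)
  -- Only `τ ∈ L¹` is known at this stage, so the pairing relies on boundedness of test gradients.
  have hbdd : ∀ F : Eucl N → Eucl N, Integrable F μ → ∀ ψ : 𝓓(ballR N R, ℝ),
      Integrable (fun x => inner ℝ (F x) (gradient (ψ : Eucl N → ℝ) x)) μ := by
    intro F hF ψ
    have hc : Continuous (fderiv ℝ (ψ : Eucl N → ℝ)) := ψ.contDiff.continuous_fderiv (by simp)
    have hc' : Continuous (fun x => gradient (ψ : Eucl N → ℝ) x) :=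
      (LinearIsometryEquiv.continuous _).comp hc
    obtain ⟨C, hC⟩ := hc.bounded_above_of_compact_support (ψ.hasCompactSupport.fderiv ℝ)
    refine (hF.norm.mul_const C).mono (hF.1.inner hc'.aestronglyMeasurable) (ae_of_all _ fun x => ?_)
    refine (norm_inner_le_norm _ _).trans ((mul_le_mul_of_nonneg_left ?_ (norm_nonneg _)).trans
      (le_abs_self _))
    rw [gradient, LinearIsometryEquiv.norm_map]
    exact hC x
  have horth : ∀ ψ : 𝓓(ballR N R, ℝ),
      Integrable (fun x => inner ℝ (σ x - τ x) (gradient (ψ : Eucl N → ℝ) x)) μ ∧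
      ∫ x, inner ℝ (σ x - τ x) (gradient (ψ : Eucl N → ℝ) x) ∂μ = 0 := by
    intro ψ
    refine ⟨hbdd _ (hσ1.sub hτ1) ψ, ?_⟩
    simp only [inner_sub_left]
    rw [integral_sub (hbdd σ hσ1 ψ) (hbdd τ hτ1 ψ), hu.2 ψ,
      integral_inner_gradient_add_radialMean hN hφ hint ψ, sub_eq_zero]
    refine integral_congr_ae ?_
    filter_upwards [hfφ] with x hx
    rw [hx]
  have hnull : RadiallyNull R fun x => inner ℝ (σ x - τ x) x := by
    intro g hg hc hs
    obtain ⟨ψ, hψ⟩ := exists_testFunction_gradient_eq (N := N) hR hg hc hs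
    rw [← (horth ψ).2]
    simp only [hψ, inner_smul_right]
    rfl
  -- The radial component of `σ` is in `L^{p'}`, and conditioning transfers this to `τ`, which is
  -- purely radial.
  have hτm : MemLp τ (ENNReal.ofReal (p / (p - 1))) μ := by
    have ha : MemLp (fun x => inner ℝ (σ x) (‖x‖⁻¹ • x)) (ENNReal.ofReal (p / (p - 1))) μ := by
      refine hσm.mono (hσm.1.inner (Measurable.aestronglyMeasurable (by fun_prop)))
        (ae_of_all _ fun x => (norm_inner_le_norm _ _).trans ?_)
      rw [norm_smul, norm_inv, norm_norm]
      exact mul_le_of_le_one_right (norm_nonneg _) inv_mul_le_one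
    have hb := RadiallyNull.memLp (b := fun ρ => -(ρ * M ρ)) (by
      rw [← ENNReal.ofReal_one]; exact ENNReal.ofReal_le_ofReal hpq.lt.le) ha
      (by fun_prop) hN hMint (by
        convert hnull using 2 with x
        rcases eq_or_ne x 0 with rfl | hx
        · simp
        have hx' : 0 < ‖x‖ := norm_pos_iff.2 hx
        simp only [hτ, inner_sub_left, inner_neg_left, inner_smul_left, inner_smul_right,
          conj_trivial, real_inner_self_eq_norm_sq]
        field_simp)
    exact hb.mono hτmeas.aestronglyMeasurable (ae_of_all _ fun x => (hnormτ x).le)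
  have hF : MemLp (fun x => σ x - τ x) (ENNReal.ofReal (p / (p - 1))) μ := hσm.sub hτm
  have h1 : ∫ x, inner ℝ (σ x - τ x) (Du x) ∂μ = 0 :=
    hu.1.integral_inner_eq_zero hpq hF horth
  -- `k` is the coefficient for which `H⁻¹(τ) = k(|x|) x`.
  set k : ℝ → ℝ := fun ρ => -((1 + |ρ * M ρ| ^ (1 / (p - 1))) * |ρ * M ρ|⁻¹ * M ρ) with hk
  have hVeq : ∀ x, HfunInv (p - 1) (τ x) = k ‖x‖ • x := by
    intro x
    rw [HfunInv, hnormτ, norm_neg, Real.norm_eq_abs, hτ, hk]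
    simp only [smul_neg, smul_smul, neg_smul]
  have hkm : Measurable k := by fun_prop
  -- `|V| ≤ 1 + |τ|^{1/(p-1)}`, and `τ ∈ L^{p/(p-1)}` puts this power in `L^p`.
  have hV : MemLp (fun x => HfunInv (p - 1) (τ x)) (ENNReal.ofReal p) μ := by
    have h := hτm.norm_rpow_div (ENNReal.ofReal (1 / (p - 1)))
    rw [ENNReal.toReal_ofReal (by positivity), ← ENNReal.ofReal_div_of_pos (by positivity),
      show p / (p - 1) / (1 / (p - 1)) = p by field_simp] at h
    refine ((memLp_const (1 : ℝ)).add h).mono ?_ (ae_of_all _ fun x => ?_)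
    · simp only [hVeq]
      exact Measurable.aestronglyMeasurable (by fun_prop)
    · refine (norm_HfunInv_le _ _).trans (le_abs_self _)
  have hhint : Integrable (fun x => inner ℝ (σ x - τ x) x) μ := by
    refine ((hσ1.sub hτ1).norm.mul_const R).mono
      ((hσ1.sub hτ1).1.inner continuous_id.aestronglyMeasurable) ?_
    filter_upwards [ae_mem_ball_volOn N R] with x hx
    refine (norm_inner_le_norm _ _).trans ((mul_le_mul_of_nonneg_left
      (mem_ball_zero_iff.1 hx).le (norm_nonneg _)).trans (le_abs_self _))
  have hVint := integrable_inner_of_memLp hF hV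
  have h2 : ∫ x, inner ℝ (σ x - τ x) (HfunInv (p - 1) (τ x)) ∂μ = 0 := by
    have e : (fun x => inner ℝ (σ x - τ x) (HfunInv (p - 1) (τ x))) =
        fun x => k ‖x‖ * inner ℝ (σ x - τ x) x := by
      ext x; rw [hVeq, inner_smul_right]
    rw [e] at hVint ⊢
    exact hnull.integral_mul_eq_zero hhint hkm hVint
  have hDint := integrable_inner_of_memLp hF hDu
  have h3 : ∫ x, inner ℝ (Hfun (p - 1) (Du x) - Hfun (p - 1) (HfunInv (p - 1) (τ x)))
      (Du x - HfunInv (p - 1) (τ x)) ∂μ = 0 := by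
    simp only [Hfun_HfunInv hp1, inner_sub_right]
    rw [integral_sub hDint hVint, h1, h2, sub_zero]
  rw [integral_eq_zero_iff_of_nonneg (fun x => inner_Hfun_sub_sub_nonneg hp1 _ _) (by
    simp only [Hfun_HfunInv hp1, inner_sub_right]
    exact hDint.sub hVint)] at h3
  filter_upwards [h3] with x hx
  have := Hfun_eq_of_inner_eq_zero hp1 hx
  rwa [Hfun_HfunInv hp1] at this

/-! ### Gradient bounds and conclusion -/

/-- Pointwise bound for the gradient of weak solutions with datum in `L^{r,∞}`. -/
theorem IsWeakSolution.exists_norm_le {p r : ℝ} (hR : 0 < R) (hN : 1 ≤ N) (hp : 1 < p)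
    (hr : 1 < r) {f u : Eucl N → ℝ} {Du : Eucl N → Eucl N} (hf : RadiallyDecreasing N R f)
    (hu : IsWeakSolution N R p f u Du) (hL : MemLorentz (ballR N R) r f) :
    ∃ C : ℝ, ∀ᵐ x ∂(volOn (ballR N R)),
      ‖Du x‖ ≤ 1 + C * ‖x‖ ^ (-((N / r - 1) / (p - 1))) := by
  have : Nonempty (Fin N) := ⟨⟨0, hN⟩⟩
  have hp1 : 0 < p - 1 := by linarith
  obtain ⟨φ, hφ, hφR, hfφ⟩ := hf.exists_measurable_profile hN
  obtain ⟨L, hL0, hL⟩ := hL.exists_setIntegral_ball_le hN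
  have hcongr : ∀ ρ ≤ R, f =ᵐ[volume.restrict (Metric.ball 0 ρ)] fun x => φ ‖x‖ := fun ρ hρ =>
    ae_restrict_of_ae_restrict_of_subset (Metric.ball_subset_ball hρ) hfφ
  have hint : Integrable (fun x : Eucl N => φ ‖x‖) := by
    have h : IntegrableOn (fun x : Eucl N => φ ‖x‖) (Metric.ball 0 R) :=
      (hL R hR le_rfl).1.congr (hcongr R le_rfl)
    refine h.integrable_of_forall_notMem_eq_zero fun x hx => hφR _ ?_
    simpa using hx
  set ω := volume.real (Metric.ball (0 : Eucl N) 1) with hω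
  have hω0 : 0 < ω :=
    ENNReal.toReal_pos (Metric.measure_ball_pos _ _ one_pos).ne' measure_ball_lt_top.ne
  have hN0 : (0 : ℝ) < N := by exact_mod_cast hN
  set A := (N * ω)⁻¹ * L with hA
  have hA0 : 0 ≤ A := by positivity
  have hM : ∀ x : Eucl N, x ≠ 0 → ‖x‖ < R →
      ‖-(‖x‖ * radialMean N φ ‖x‖)‖ ≤ A * ‖x‖ ^ (-(N / r - 1)) := by
    intro x hx hxR
    have hx' : 0 < ‖x‖ := norm_pos_iff.2 hx
    have h1 : |radialMean N φ ‖x‖| ≤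
        (N * ω * ‖x‖ ^ N)⁻¹ * (L * (‖x‖ ^ N) ^ (1 - 1 / r)) := by
      refine abs_radialMean_le φ |>.trans ?_
      rw [radialMean_eq_setIntegral_ball hN _ hx']
      gcongr
      refine le_trans (le_of_eq ?_) (hL _ hx' hxR.le).2
      refine integral_congr_ae ?_
      filter_upwards [hcongr _ hxR.le] with y hy
      rw [hy]
    rw [norm_neg, norm_mul, norm_norm, Real.norm_eq_abs]
    refine (mul_le_mul_of_nonneg_left h1 hx'.le).trans_eq ?_
    -- Exponent count: `-N + N(1 - 1/r) + 1 = 1 - N/r`.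
    have h2 : ‖x‖ ^ (-(N / r - 1)) = (‖x‖ ^ N)⁻¹ * (‖x‖ ^ N) ^ (1 - 1 / r) * ‖x‖ := by
      rw [← Real.rpow_natCast, ← Real.rpow_mul hx'.le, ← Real.rpow_neg hx'.le, ← Real.rpow_add hx']
      nth_rw 3 [← Real.rpow_one ‖x‖]
      rw [← Real.rpow_add hx']
      congr 1
      ring
    rw [h2, hA, mul_inv]
    ring
  have hbound : ∀ᵐ x ∂(volOn (ballR N R)),
      ‖-(‖x‖ * radialMean N φ ‖x‖)‖ ≤ A * ‖x‖ ^ (-(N / r - 1)) := by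
    have hne : ∀ᵐ x ∂(volOn (ballR N R)), x ≠ 0 := ae_restrict_of_ae (Measure.ae_ne volume 0)
    filter_upwards [hne, ae_mem_ball_volOn N R] with x hx hxR
    exact hM x hx (mem_ball_zero_iff.1 hxR)
  have hmeas := measurable_radialMean N hφ
  have hMint : Integrable (fun x : Eucl N => -(‖x‖ * radialMean N φ ‖x‖)) (volOn (ballR N R)) := by
    refine integrableOn_ball_of_norm_le_rpow (by rw [finrank_euclideanSpace_fin]; exact hN) ?_
      hbound (Measurable.aestronglyMeasurable (by fun_prop))
    rw [finrank_euclideanSpace_fin]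
    have : (N : ℝ) / r ≤ N := div_le_self hN0.le hr.le
    linarith
  refine ⟨A ^ (1 / (p - 1)), ?_⟩
  filter_upwards [hu.Hfun_ae_eq hR hN hp hφ hint hfφ hMint, hbound] with x hx hb
  refine (norm_le_of_Hfun_eq hp1 hx).trans ?_
  have e : ‖-(radialMean N φ ‖x‖ • x)‖ = ‖-(‖x‖ * radialMean N φ ‖x‖)‖ := by
    simp [norm_smul, mul_comm]
  have e2 : A ^ (1 / (p - 1)) * ‖x‖ ^ (-((N / r - 1) / (p - 1))) =
      (A * ‖x‖ ^ (-(N / r - 1))) ^ (1 / (p - 1)) := by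
    rw [Real.mul_rpow hA0 (by positivity), ← Real.rpow_mul (norm_nonneg _)]
    congr 2
    ring
  rw [e, e2]
  gcongr

lemma memLp_norm_rpow_ball (hN : 1 ≤ N) {β q : ℝ} (hq : 0 < q) (hβ : β * q < N) :
    MemLp (fun x : Eucl N => ‖x‖ ^ (-β)) (ENNReal.ofReal q) (volOn (ballR N R)) := by
  have hm : Measurable (fun x : Eucl N => ‖x‖ ^ (-β)) := by fun_prop
  rw [← integrable_norm_rpow_iff hm.aestronglyMeasurable (by simpa using hq) ENNReal.ofReal_ne_top,
    ENNReal.toReal_ofReal hq.le]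
  refine integrableOn_ball_of_norm_le_rpow (C := 1) (α := β * q)
    (by rw [finrank_euclideanSpace_fin]; exact hN) (by rwa [finrank_euclideanSpace_fin])
    (ae_of_all _ fun x => ?_) (hm.norm.pow_const q).aestronglyMeasurable
  rw [Real.norm_of_nonneg (by positivity), Real.norm_of_nonneg (by positivity),
    ← Real.rpow_mul (norm_nonneg _), one_mul, neg_mul]

theorem corollary1 (N : ℕ) (hN : 2 ≤ N) (R : ℝ) (hR : 0 < R) (p : ℝ) (hp : 1 < p)
    (f : Eucl N → ℝ) (hf : RadiallyDecreasing N R f)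
    (u : Eucl N → ℝ) (Du : Eucl N → Eucl N) (hu : IsWeakSolution N R p f u Du) :
    (∀ r : ℝ, 1 < r → r < N → MemLorentz (ballR N R) r f →
      ∀ q : ℝ, 0 < q → q < N * r * (p - 1) / (N - r) →
        MemLp Du (ENNReal.ofReal q) (volOn (ballR N R))) ∧
    (MemLorentz (ballR N R) (N : ℝ) f → MemLp Du ∞ (volOn (ballR N R))) := by
  have hN1 : 1 ≤ N := by omega
  have hp1 : 0 < p - 1 := by linarith
  have hDu : AEStronglyMeasurable Du (volOn (ballR N R)) := hu.1.1.2.2.1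
  constructor
  · intro r hr hrN hL q hq hqlt
    obtain ⟨C, hC⟩ := hu.exists_norm_le hR hN1 hp hr hf hL
    -- Since `(N/r - 1)/(p - 1) = (N - r)/(r(p - 1))`, this is exactly the assumed bound on `q`.
    have hβ : (N / r - 1) / (p - 1) * q < N := by
      have hr0 : 0 < r := by linarith
      have hNr : 0 < (N : ℝ) - r := by linarith
      rw [lt_div_iff₀ hNr] at hqlt
      rw [div_sub_one hr0.ne', div_div, div_mul_eq_mul_div, div_lt_iff₀ (by positivity)]
      linarith
    refine ((memLp_const (1 : ℝ)).add ((memLp_norm_rpow_ball hN1 hq hβ).const_mul C)).mono hDu ?_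
    filter_upwards [hC] with x hx
    exact hx.trans (le_abs_self _)
  · intro hL
    have hN' : (1 : ℝ) < N := by exact_mod_cast (by omega : 1 < N)
    obtain ⟨C, hC⟩ := hu.exists_norm_le hR hN1 hp hN' hf hL
    refine memLp_top_of_bound hDu (1 + C) ?_
    filter_upwards [hC] with x hx
    -- For `r = N` the exponent of `|x|` is zero, so the pointwise bound is the constant `1 + C`.
    simpa [div_self (by linarith : (N : ℝ) ≠ 0)] using hx
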